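/- Let $\sigma,\beta>0$, $\rho\ge -1$ and $\gamma\in\mathbb R$ satisfy $|\gamma|<(1-\rho)\sqrt{\pi\beta}$ (so that $\rho<1$). Let $W$ be a standard one-dimensional Brownian motion on a probability space $(\Omega,\mathcal F,\mathbb P)$, and let $\phi_t(\omega,x)$, $t\ge 0$, $x\in\mathbb R^3$, be the solution map (random dynamical system) of the stochastic Lorenz 63 system $$ \begin{aligned} dX&=\sigma(Y-X)\,dt,\\ dY&=(\rho X-Y-XZ)\,dt,\\ dZ&=(-\beta Z+XY)\,dt+\gamma\,dW_t, \end{aligned} $$ that is, for almost every $\omega$ and every $x\in\mathbb R^3$, $t\mapsto\phi_t(\omega,x)$ is the continuous solution with $\phi_0(\omega,x)=x$. Then $\phi$ is locally asymptotically stable (at the origin): there are $\varepsilon>0$ and a deterministic sequence of times $t_n\uparrow\infty$ such that, with $B(0,\varepsilon)$ the open Euclidean ball, $$ \mathbb P\Big(\lim_{n\to\infty}\operatorname{diam}\,\phi_{t_n}\big(\cdot,B(0,\varepsilon)\big)=0\Big)>0 . $$ -/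

import Mathlib

open MeasureTheory ProbabilityTheory Filter Topology
open scoped NNReal ENNReal

noncomputable section

/-- The drift of the Lorenz 63 system,
`(X, Y, Z) ↦ (σ (Y - X), ρ X - Y - X Z, -β Z + X Y)`. -/
def lorenzDrift (σ ρ β : ℝ) (u : EuclideanSpace ℝ (Fin 3)) : EuclideanSpace ℝ (Fin 3) :=
  !₂[σ * (u 1 - u 0), ρ * u 0 - u 1 - u 0 * u 2, -β * u 2 + u 0 * u 1]

/-- `u` solves the Lorenz 63 system with initial value `x`, forced by the path `w` with
intensity `γ` in the third coordinate:
`u t = x + ∫₀ᵗ lorenzDrift (u s) ds + (0, 0, γ (w t - w 0))` for all `t ≥ 0`, `u` continuous.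
The noise being additive, its stochastic integral is `γ (w t - w 0)`, path by path. -/
def IsLorenzSolution (σ ρ β γ : ℝ) (w : ℝ≥0 → ℝ) (x : EuclideanSpace ℝ (Fin 3))
    (u : ℝ≥0 → EuclideanSpace ℝ (Fin 3)) : Prop :=
  Continuous u ∧ ∀ t : ℝ≥0,
    u t = x + (∫ s in (0 : ℝ)..(t : ℝ), lorenzDrift σ ρ β (u s.toNNReal))
      + !₂[0, 0, γ * (w t - w 0)]

/-- `φ t ω x` is the solution map (random dynamical system) generated by the stochastic
Lorenz 63 system driven by `W`: for almost every `ω`, and all initial values `x` at once,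
`t ↦ φ t ω x` is the solution started at `x`. -/
def IsStochasticLorenzFlow {Ω : Type*} [MeasurableSpace Ω] (P : Measure Ω) (σ ρ β γ : ℝ)
    (W : ℝ≥0 → Ω → ℝ)
    (φ : ℝ≥0 → Ω → EuclideanSpace ℝ (Fin 3) → EuclideanSpace ℝ (Fin 3)) : Prop :=
  ∀ᵐ ω ∂P, ∀ x, IsLorenzSolution σ ρ β γ (fun t => W t ω) x (fun t => φ t ω x)

/-- `φ` is asymptotically stable on the non-empty open set `U`: along some deterministic
sequence of times increasing to infinity, the diameter of `φ (t n) ω U` tends to zero with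
positive probability. The diameter takes values in `[0, ∞]`. -/
def AsymptoticallyStableOn {Ω E : Type*} [MeasurableSpace Ω] [MetricSpace E] (P : Measure Ω)
    (φ : ℝ≥0 → Ω → E → E) (U : Set E) : Prop :=
  U.Nonempty ∧ IsOpen U ∧ ∃ t : ℕ → ℝ≥0, StrictMono t ∧ Tendsto t atTop atTop ∧
    0 < P {ω | Tendsto (fun n => Metric.ediam (φ (t n) ω '' U)) atTop (𝓝 0)}

/-- `φ` is locally asymptotically stable at `z`: it is asymptotically stable on some ball
centred at `z`. -/
def LocallyAsymptoticallyStableAt {Ω E : Type*} [MeasurableSpace Ω] [MetricSpace E]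
    (P : Measure Ω) (φ : ℝ≥0 → Ω → E → E) (z : E) : Prop :=
  ∃ ε : ℝ, 0 < ε ∧ AsymptoticallyStableOn P φ (Metric.ball z ε)

end

/-! The z-axis is invariant, and the solution from the origin moves on it as an Ornstein-Uhlenbeck
path `Zs` started at 0. Transversally, a quadratic form V in (X, Y) satisfies V' ≤ 2κ(ρ - 1 + |Z|)V
with κ = σ/(1 + σ) (`lorenzLyapunov_deriv_le`). The stationary mean of |Zs| is |γ|/√(πβ) < 1 - ρ, so
if Z stays near `Zs`, V decays exponentially; conversely Z - `Zs` solves a damped linear equation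
forced only by XY, which V controls. A continuity argument closes this loop for small initial data
(`IsLorenzPath.exp_decay`).

The time average of |Zs| is bounded without an ergodic theorem. Implicit Euler schemes are Gaussian
autoregressions whose variance never exceeds the stationary one and whose absolute values have
geometrically decaying covariances. Chebyshev and Fatou carry this to ∫|Zs| over [0, T], with
variance-type bound O(T); Borel-Cantelli along T = n² and monotonicity in T give ∫₀ᵗ|Zs| ≤ C + c't
almost surely, with c' < 1 - ρ and a random C. The ball radius depends on C, so C is fixed on an
event of positive probability. -/

/-- The first absolute moment of a centred Gaussian. -/
lemma integral_abs_gaussianReal (v : ℝ≥0) :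
    ∫ x, |x| ∂(gaussianReal 0 v) = √(2 * v / Real.pi) := by
  by_cases hv : v = 0
  · simp [hv]
  have hv' : (0 : ℝ) < v := by positivity
  rw [integral_gaussianReal_eq_integral_smul hv]
  have h1 : ∀ x : ℝ, gaussianPDFReal 0 v x • |x|
      = (fun y : ℝ => (√(2 * Real.pi * v))⁻¹ *
        (y ^ (1 : ℝ) * Real.exp (-(2 * v : ℝ)⁻¹ * y ^ (2 : ℝ)))) |x| := by
    intro x
    simp only [gaussianPDFReal, smul_eq_mul, sub_zero, Real.rpow_one, Real.rpow_two, sq_abs]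
    rw [show -x ^ 2 / (2 * (v : ℝ)) = -(2 * v : ℝ)⁻¹ * x ^ 2 by ring]
    ring
  simp_rw [h1]
  rw [integral_comp_abs (f := fun y : ℝ => (√(2 * Real.pi * v))⁻¹ *
        (y ^ (1 : ℝ) * Real.exp (-(2 * v : ℝ)⁻¹ * y ^ (2 : ℝ)))), integral_const_mul,
    integral_rpow_mul_exp_neg_mul_rpow (by norm_num) (by norm_num) (by positivity)]
  norm_num
  rw [Real.rpow_neg_one]
  have h2 : √(v : ℝ) * √(v : ℝ) = v := Real.mul_self_sqrt hv'.le
  have h4 : √2 * √2 = (2 : ℝ) := Real.mul_self_sqrt (by norm_num)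
  field_simp
  linear_combination -(√2 * √2) * h2 - v * h4

lemma MeasureTheory.MemLp.fun_abs {Ω : Type*} [MeasurableSpace Ω] {P : Measure Ω}
    {p : ℝ≥0∞} {f : Ω → ℝ} (hf : MemLp f p P) : MemLp (fun ω => |f ω|) p P :=
  hf.abs

/-! ### Gaussian autoregressions: moments and covariances. -/

/-- The solution of the recursion `s (k + 1) = a * (s k + g * x k)`, `s 0 = 0`. -/
noncomputable def arOne (a g : ℝ) (x : ℕ → ℝ) : ℕ → ℝ
  | 0 => 0
  | k + 1 => a * (arOne a g x k + g * x k)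

/-- Restarting at time k separates a damped memory of the past from a fresh copy driven by later
noise alone; all decorrelation estimates rest on this. -/
lemma arOne_add (a g : ℝ) (x : ℕ → ℝ) (k j : ℕ) :
    arOne a g x (k + j) = a ^ j * arOne a g x k + arOne a g (fun i => x (k + i)) j := by
  induction j with
  | zero => simp [arOne]
  | succ j ih => rw [← add_assoc, arOne, ih, arOne]; ring

lemma arOne_congr (a g : ℝ) {x y : ℕ → ℝ} {k : ℕ} (h : ∀ i < k, x i = y i) :
    arOne a g x k = arOne a g y k := by
  induction k with
  | zero => rfl
  | succ k ih => rw [arOne, arOne, ih fun i hi => h i (by omega), h k (by omega)]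

lemma measurable_arOne (a g : ℝ) (k : ℕ) : Measurable fun x : ℕ → ℝ => arOne a g x k := by
  induction k with
  | zero => exact measurable_const
  | succ k ih => exact (ih.add ((measurable_pi_apply k).const_mul g)).const_mul a

section Gaussian

variable {Ω : Type*} [MeasurableSpace Ω] {P : Measure Ω} {ξ : ℕ → Ω → ℝ} {v : ℝ≥0} {a g : ℝ}

lemma aemeasurable_arOne (hm : ∀ i, AEMeasurable (ξ i) P) (k : ℕ) :
    AEMeasurable (fun ω => arOne a g (fun i => ξ i ω) k) P :=
  (measurable_arOne a g k).comp_aemeasurable (aemeasurable_pi_lambda _ hm)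

lemma indepFun_arOne (hi : iIndepFun ξ P) (hm : ∀ i, AEMeasurable (ξ i) P) (k j : ℕ) :
    IndepFun (fun ω => arOne a g (fun i => ξ i ω) k)
      (fun ω (i : Finset.Ico k (k + j)) => ξ i ω) P := by
  have h := hi.indepFun_finset₀ (Finset.range k) (Finset.Ico k (k + j))
    (by rw [Finset.disjoint_left]; intro i; simp; omega) hm
  -- Padding a finite tuple by zeros loses nothing, since `arOne` at time k reads only the indices
  -- below k.
  let e : (Finset.range k → ℝ) → ℕ → ℝ := fun y i =>
    if hi : i ∈ Finset.range k then y ⟨i, hi⟩ else 0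
  have he : Measurable e := by
    refine measurable_pi_lambda _ fun i => ?_
    by_cases hi : i ∈ Finset.range k
    · simpa only [e, hi, dif_pos] using
        measurable_pi_apply (X := fun _ : Finset.range k => ℝ) ⟨i, hi⟩
    · simp only [e, hi, dif_neg, not_false_eq_true, measurable_const]
  have hS : (fun ω => arOne a g (fun i => ξ i ω) k)
      = ((fun x => arOne a g x k) ∘ e) ∘ fun ω (i : Finset.range k) => ξ i ω := by
    ext ω
    refine arOne_congr a g fun i hi => ?_
    simp [e, hi]
  rw [hS]
  exact h.comp ((measurable_arOne a g k).comp he) measurable_id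

lemma indepFun_arOne_shift (hi : iIndepFun ξ P) (hm : ∀ i, AEMeasurable (ξ i) P) (k j : ℕ) :
    IndepFun (fun ω => arOne a g (fun i => ξ i ω) k)
      (fun ω => arOne a g (fun i => ξ (k + i) ω) j) P := by
  have h := indepFun_arOne (a := a) (g := g) hi hm k j
  let e : (Finset.Ico k (k + j) → ℝ) → ℕ → ℝ := fun y i =>
    if hi : k + i ∈ Finset.Ico k (k + j) then y ⟨k + i, hi⟩ else 0
  have he : Measurable e := by
    refine measurable_pi_lambda _ fun i => ?_
    by_cases hi : k + i ∈ Finset.Ico k (k + j)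
    · simpa only [e, hi, dif_pos] using
        measurable_pi_apply (X := fun _ : Finset.Ico k (k + j) => ℝ) ⟨k + i, hi⟩
    · simp only [e, hi, dif_neg, not_false_eq_true, measurable_const]
  have hS : (fun ω => arOne a g (fun i => ξ (k + i) ω) j)
      = ((fun x => arOne a g x j) ∘ e) ∘ fun ω (i : Finset.Ico k (k + j)) => ξ i ω := by
    ext ω
    refine arOne_congr a g fun i hi => ?_
    simp [e, hi]
  rw [hS]
  exact h.comp measurable_id ((measurable_arOne a g j).comp he)

/-- The variance obeys w ↦ a²(w + g²v). By `hs` this monotone map sends [0, s] into itself, and the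
recursion starts at 0. -/
lemma hasLaw_arOne [IsProbabilityMeasure P] (hi : iIndepFun ξ P)
    (hl : ∀ i, HasLaw (ξ i) (gaussianReal 0 v) P) {s : ℝ≥0}
    (hs : a ^ 2 * (s + g ^ 2 * v) ≤ s) (k : ℕ) :
    ∃ w : ℝ≥0, w ≤ s ∧ HasLaw (fun ω => arOne a g (fun i => ξ i ω) k) (gaussianReal 0 w) P := by
  have hm : ∀ i, AEMeasurable (ξ i) P := fun i => (hl i).aemeasurable
  induction k with
  | zero =>
    refine ⟨0, zero_le, ?_⟩
    simp only [arOne, gaussianReal_zero_var]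
    exact ⟨aemeasurable_const, by simp [Measure.map_const]⟩
  | succ k ih =>
    obtain ⟨w, hw, h⟩ := ih
    have hin : IndepFun (fun ω => arOne a g (fun i => ξ i ω) k) (fun ω => g * ξ k ω) P :=
      (indepFun_arOne (a := a) (g := g) hi hm k 1).comp 
        (ψ := fun y : Finset.Ico k (k + 1) → ℝ => g * y ⟨k, by simp⟩) measurable_id (by fun_prop)
    have h2 := gaussianReal_const_mul (hl k) g
    have h3 := gaussianReal_add_gaussianReal_of_indepFun hin h.map_eq h2.map_eq
    have h4 := gaussianReal_const_mul ⟨h.aemeasurable.add h2.aemeasurable, h3⟩ a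
    refine ⟨_, ?_, by simpa [arOne] using h4⟩
    rw [← NNReal.coe_le_coe]
    push_cast
    refine le_trans ?_ hs
    have : (w : ℝ) ≤ s := hw
    change a ^ 2 * ((w : ℝ) + g ^ 2 * v) ≤ _
    gcongr

lemma memLp_arOne [IsProbabilityMeasure P]
    (hl : ∀ i, HasLaw (ξ i) (gaussianReal 0 v) P) (k : ℕ) :
    MemLp (fun ω => arOne a g (fun i => ξ i ω) k) 2 P := by
  induction k with
  | zero => exact memLp_const 0
  | succ k ih =>
    have : MemLp (ξ k) 2 P := by
      have h := (hl k).map_eq ▸ memLp_id_gaussianReal' (μ := 0) (v := v) 2 (by simp)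
      exact (memLp_map_measure_iff aestronglyMeasurable_id (hl k).aemeasurable).1 h
    exact (ih.add (this.const_mul g)).const_mul a

lemma integral_abs_arOne_le [IsProbabilityMeasure P] (hi : iIndepFun ξ P)
    (hl : ∀ i, HasLaw (ξ i) (gaussianReal 0 v) P) {s : ℝ≥0}
    (hs : a ^ 2 * (s + g ^ 2 * v) ≤ s) (k : ℕ) :
    ∫ ω, |arOne a g (fun i => ξ i ω) k| ∂P ≤ √(2 * s / Real.pi) := by
  obtain ⟨w, hw, h⟩ := hasLaw_arOne hi hl hs k
  have := h.integral_comp (f := fun x => |x|) (by fun_prop)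
  simp only [Function.comp_def] at this
  rw [this, integral_abs_gaussianReal]
  have : (w : ℝ) ≤ s := hw
  gcongr

lemma integral_sq_arOne_le [IsProbabilityMeasure P] (hi : iIndepFun ξ P)
    (hl : ∀ i, HasLaw (ξ i) (gaussianReal 0 v) P) {s : ℝ≥0}
    (hs : a ^ 2 * (s + g ^ 2 * v) ≤ s) (k : ℕ) :
    ∫ ω, arOne a g (fun i => ξ i ω) k ^ 2 ∂P ≤ s := by
  obtain ⟨w, hw, h⟩ := hasLaw_arOne hi hl hs k
  have := h.integral_comp (f := fun x => x ^ 2) (by fun_prop)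
  simp only [Function.comp_def] at this
  rw [this]
  have h2 := variance_fun_id_gaussianReal (μ := 0) (v := w)
  rw [variance_eq_integral measurable_id'.aemeasurable] at h2
  simp only [integral_id_gaussianReal, sub_zero] at h2
  rw [h2]
  exact_mod_cast hw

/-- Write Y = aʲX + R with R independent of X. Replacing |Y| by |Y| - |R| leaves the covariance with
|X| unchanged, and this difference is at most aʲ|X|. The two terms of the covariance then cost aʲ E
X² each. -/
lemma covariance_abs_arOne_le [IsProbabilityMeasure P] (hi : iIndepFun ξ P)
    (hl : ∀ i, HasLaw (ξ i) (gaussianReal 0 v) P) {s : ℝ≥0} (ha : 0 ≤ a)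
    (hs : a ^ 2 * (s + g ^ 2 * v) ≤ s) (k j : ℕ) :
    cov[fun ω => |arOne a g (fun i => ξ i ω) k|,
      fun ω => |arOne a g (fun i => ξ i ω) (k + j)|; P] ≤ 2 * s * a ^ j := by
  have hm : ∀ i, AEMeasurable (ξ i) P := fun i => (hl i).aemeasurable
  set X := fun ω => arOne a g (fun i => ξ i ω) k with hX
  set Y := fun ω => arOne a g (fun i => ξ i ω) (k + j) with hY
  set R := fun ω => arOne a g (fun i => ξ (k + i) ω) j with hR
  have mX : MemLp X 2 P := memLp_arOne hl k
  have mY : MemLp Y 2 P := memLp_arOne hl (k + j)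
  have mR : MemLp R 2 P :=
    memLp_arOne (fun i => hl _) j
  have hind : cov[fun ω => |X ω|, fun ω => |R ω|; P] = 0 :=
    ((indepFun_arOne_shift hi hm k j).comp (φ := fun x => |x|) (ψ := fun x => |x|)
      (by fun_prop) (by fun_prop)).covariance_eq_zero mX.fun_abs mR.fun_abs
  have hD : ∀ ω, |(|Y ω| - |R ω|)| ≤ a ^ j * |X ω| := by
    intro ω
    have h := arOne_add a g (fun i => ξ i ω) k j
    calc |(|Y ω| - |R ω|)| ≤ |Y ω - R ω| := abs_abs_sub_abs_le _ _
      _ = |a ^ j * X ω| := by rw [hY, hR, hX]; simp only [h]; ring_nf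
      _ = a ^ j * |X ω| := by rw [abs_mul, abs_of_nonneg (by positivity)]
  have mD : MemLp (fun ω => |Y ω| - |R ω|) 2 P := mY.fun_abs.sub mR.fun_abs
  have iX : Integrable (fun ω => |X ω|) P := mX.fun_abs.integrable one_le_two
  have iD := mD.integrable one_le_two
  have h1 : cov[fun ω => |X ω|, fun ω => |Y ω|; P]
      = cov[fun ω => |X ω|, fun ω => |Y ω| - |R ω|; P] := by
    rw [covariance_fun_sub_right mX.fun_abs mY.fun_abs mR.fun_abs, hind, sub_zero]
  rw [h1, covariance_eq_sub mX.fun_abs mD]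
  have e0 : ∫ ω, X ω ^ 2 ∂P ≤ s := integral_sq_arOne_le hi hl hs k
  have e1 : ∫ ω, |X ω| * (|Y ω| - |R ω|) ∂P ≤ a ^ j * s := by
    calc _ ≤ ∫ ω, a ^ j * X ω ^ 2 ∂P := by
          refine integral_mono (mX.fun_abs.integrable_mul mD) (mX.integrable_sq.const_mul _) fun ω => ?_
          have := le_of_abs_le (hD ω)
          have h2 := abs_nonneg (X ω)
          calc |X ω| * (|Y ω| - |R ω|) ≤ |X ω| * (a ^ j * |X ω|) := by gcongr
            _ = a ^ j * X ω ^ 2 := by rw [← sq_abs (X ω)]; ring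
      _ ≤ _ := by rw [integral_const_mul]; gcongr
  have e2 : -(∫ ω, (|Y ω| - |R ω|) ∂P) ≤ a ^ j * ∫ ω, |X ω| ∂P := by
    rw [← integral_neg, ← integral_const_mul]
    exact integral_mono iD.neg (iX.const_mul _) fun ω => by
      have := neg_le_of_abs_le (hD ω); simp only; linarith
  have e3 : 0 ≤ ∫ ω, |X ω| ∂P := integral_nonneg fun _ => abs_nonneg _
  have e4 : (∫ ω, |X ω| ∂P) ^ 2 ≤ s := by
    have h := variance_nonneg (fun ω => |X ω|) P
    rw [variance_eq_sub mX.fun_abs] at h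
    simp only [Pi.pow_apply, sq_abs] at h
    linarith
  have e5 : -((∫ ω, |X ω| ∂P) * ∫ ω, (|Y ω| - |R ω|) ∂P) ≤ a ^ j * s := by
    calc _ = (∫ ω, |X ω| ∂P) * -(∫ ω, (|Y ω| - |R ω|) ∂P) := by ring
      _ ≤ (∫ ω, |X ω| ∂P) * (a ^ j * ∫ ω, |X ω| ∂P) := by gcongr
      _ = a ^ j * (∫ ω, |X ω| ∂P) ^ 2 := by ring
      _ ≤ _ := by gcongr
  simp only [Pi.mul_apply] at *
  linarith

/-- Each new term adds its variance and twice its covariance with the past. The geometric series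
bounds these by 2s/(1 - a) and 2 · 2s/(1 - a), whence the 6. -/
lemma variance_sum_abs_arOne_le [IsProbabilityMeasure P] (hi : iIndepFun ξ P)
    (hl : ∀ i, HasLaw (ξ i) (gaussianReal 0 v) P) {s : ℝ≥0} (ha : 0 ≤ a) (ha1 : a < 1)
    (hs : a ^ 2 * (s + g ^ 2 * v) ≤ s) (K : ℕ) :
    Var[fun ω => ∑ k ∈ Finset.range K, |arOne a g (fun i => ξ i ω) k|; P]
      ≤ K * (6 * s / (1 - a)) := by
  have m := fun k => (memLp_arOne (a := a) (g := g) hl k).fun_abs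
  induction K with
  | zero => simp [variance_zero, ← Pi.zero_def]
  | succ K ih =>
    simp_rw [Finset.sum_range_succ]
    have hF : MemLp (fun ω => ∑ k ∈ Finset.range K, |arOne a g (fun i => ξ i ω) k|) 2 P :=
      memLp_finsetSum _ fun k _ => m k
    rw [variance_fun_add hF (m K)]
    have h1 : Var[fun ω => |arOne a g (fun i => ξ i ω) K|; P] ≤ 2 * s := by
      rw [← covariance_self (m K).aemeasurable]
      simpa using covariance_abs_arOne_le hi hl ha hs K 0
    have h2 : cov[fun ω => ∑ k ∈ Finset.range K, |arOne a g (fun i => ξ i ω) k|,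
        fun ω => |arOne a g (fun i => ξ i ω) K|; P] ≤ 2 * s * (1 / (1 - a) ) := by
      rw [covariance_fun_sum_left' (fun k _ => m k) (m K)]
      calc _ ≤ ∑ k ∈ Finset.range K, 2 * s * a ^ (K - k) := by
            refine Finset.sum_le_sum fun k hk => ?_
            have hk' := Finset.mem_range.1 hk
            have h := covariance_abs_arOne_le (a := a) (g := g) hi hl ha hs k (K - k)
            rwa [Nat.add_sub_cancel' hk'.le] at h
        -- Giving away one power of a lets the sum be reflected into a geometric one.
        _ ≤ ∑ k ∈ Finset.range K, 2 * s * a ^ (K - 1 - k) := by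
            refine Finset.sum_le_sum fun k hk => ?_
            exact mul_le_mul_of_nonneg_left
              (pow_le_pow_of_le_one ha ha1.le (by omega)) (by positivity)
        _ = 2 * s * ∑ k ∈ Finset.range K, a ^ k := by
            rw [Finset.sum_range_reflect (fun k => 2 * (s : ℝ) * a ^ k), Finset.mul_sum]
        _ ≤ _ := by
            gcongr
            rw [geom_sum_eq ha1.ne, ← neg_div_neg_eq]
            have : 0 < 1 - a := by linarith
            have := pow_nonneg ha K
            rw [neg_sub, neg_sub]
            gcongr
            linarith
    have h3 : 2 * (s : ℝ) ≤ 2 * s * (1 / (1 - a)) := by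
      refine le_mul_of_one_le_right (by positivity) ?_
      rw [le_div_iff₀ (by linarith)]; linarith
    have h4 : 6 * (s : ℝ) / (1 - a) = 3 * (2 * s * (1 / (1 - a))) := by ring
    push_cast
    rw [add_mul, one_mul]
    linarith

end Gaussian

/-! ### One-sided Chebyshev bounds in the limit. -/

section Chebyshev

variable {Ω : Type*} [MeasurableSpace Ω] {P : Measure Ω}

/-- The positive part appears because c is only an upper bound for the mean. -/
lemma lintegral_sq_posPart_sub_le [IsProbabilityMeasure P] {F : Ω → ℝ} (hF : MemLp F 2 P)
    {c K : ℝ} (hc : ∫ ω, F ω ∂P ≤ c) (hK : Var[F; P] ≤ K) :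
    ∫⁻ ω, ENNReal.ofReal (max (F ω - c) 0 ^ 2) ∂P ≤ ENNReal.ofReal K := by
  calc _ ≤ ∫⁻ ω, ENNReal.ofReal ((F ω - ∫ ω, F ω ∂P) ^ 2) ∂P := by
        refine lintegral_mono fun ω => ENNReal.ofReal_le_ofReal ?_
        rw [sq_le_sq, abs_of_nonneg (le_max_right _ _)]
        exact max_le ((by linarith : F ω - c ≤ F ω - ∫ ω, F ω ∂P).trans (le_abs_self _))
          (abs_nonneg _)
    _ = ENNReal.ofReal (Var[F; P]) := by
        rw [hF.ofReal_variance_eq, evariance_eq_lintegral_ofReal]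
    _ ≤ _ := ENNReal.ofReal_le_ofReal hK

/-- A one-sided Chebyshev inequality that passes to almost sure limits. -/
lemma measure_ge_le_of_tendsto {F : ℕ → Ω → ℝ} {A : Ω → ℝ} {c K d : ℝ} (hd : 0 < d)
    (hF : ∀ n, AEMeasurable (F n) P)
    (hK : ∀ n, ∫⁻ ω, ENNReal.ofReal (max (F n ω - c) 0 ^ 2) ∂P ≤ ENNReal.ofReal K)
    (hA : ∀ᵐ ω ∂P, Tendsto (fun n => F n ω) atTop (𝓝 (A ω))) :
    P {ω | c + d ≤ A ω} ≤ ENNReal.ofReal (K / d ^ 2) := by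
  have hG : ∀ n, AEMeasurable (fun ω => ENNReal.ofReal (max (F n ω - c) 0 ^ 2)) P := fun n =>
    (((hF n).sub_const c).max aemeasurable_const |>.pow_const 2).ennreal_ofReal
  have hlim : ∀ᵐ ω ∂P, liminf (fun n => ENNReal.ofReal (max (F n ω - c) 0 ^ 2)) atTop
      = ENNReal.ofReal (max (A ω - c) 0 ^ 2) := by
    filter_upwards [hA] with ω hω
    exact (ENNReal.tendsto_ofReal
      (((hω.sub_const c).max tendsto_const_nhds).pow 2)).liminf_eq
  have hfatou := (lintegral_liminf_le' (u := atTop) hG).trans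
    ((liminf_le_liminf (Eventually.of_forall hK)).trans_eq (liminf_const _))
  have hmeas : AEMeasurable
      (fun ω => liminf (fun n => ENNReal.ofReal (max (F n ω - c) 0 ^ 2)) atTop) P := by
    refine aemeasurable_of_tendsto_metrizable_ae (g := fun ω => ENNReal.ofReal (max (A ω - c) 0 ^ 2))
      atTop hG ?_ |>.congr (hlim.mono fun ω h => h.symm)
    filter_upwards [hA] with ω hω
    exact ENNReal.tendsto_ofReal (((hω.sub_const c).max tendsto_const_nhds).pow 2)
  have hd2 : ENNReal.ofReal (d ^ 2) ≠ 0 := by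
    rw [Ne, ENNReal.ofReal_eq_zero, not_le]; positivity
  have hsub : P {ω | c + d ≤ A ω} ≤ P {ω | ENNReal.ofReal (d ^ 2)
      ≤ liminf (fun n => ENNReal.ofReal (max (F n ω - c) 0 ^ 2)) atTop} := by
    refine measure_mono_ae ?_
    filter_upwards [hlim] with ω hω h
    change c + d ≤ A ω at h
    change _ ≤ liminf _ _
    rw [hω]
    refine ENNReal.ofReal_le_ofReal ?_
    have : d ≤ max (A ω - c) 0 := (by linarith : d ≤ A ω - c).trans (le_max_left _ _)
    gcongr
  have hmk := mul_meas_ge_le_lintegral₀ hmeas (ENNReal.ofReal (d ^ 2))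
  rw [ENNReal.ofReal_div_of_pos (by positivity)]
  refine hsub.trans ?_
  rw [ENNReal.le_div_iff_mul_le (Or.inl hd2) (Or.inl ENNReal.ofReal_ne_top), mul_comm]
  exact hmk.trans hfatou

end Chebyshev

/-! ### Time averages of the Ornstein-Uhlenbeck scheme. -/

/-- The implicit Euler scheme with step `1 / (N + 1)` for `dZ = -β Z dt + γ dw`, `Z 0 = 0`. -/
noncomputable def ouEuler (β γ : ℝ) (w : ℝ≥0 → ℝ) (N : ℕ) : ℕ → ℝ :=
  arOne (1 + β / (N + 1))⁻¹ γ
    (fun i => w (((i + 1 : ℕ) : ℝ≥0) / (N + 1)) - w ((i : ℝ≥0) / (N + 1)))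

section OrnsteinUhlenbeck

variable {Ω : Type*} [MeasurableSpace Ω] {P : Measure Ω} {W : ℝ≥0 → Ω → ℝ} {β : ℝ}

lemma iIndepFun_brownian_grid (hW : IsPreBrownianReal W P) (N : ℕ) :
    iIndepFun (fun (i : ℕ) ω => W (((i + 1 : ℕ) : ℝ≥0) / (N + 1)) ω
      - W ((i : ℝ≥0) / (N + 1)) ω) P :=
  hW.hasIndepIncrements.nat (t := fun i : ℕ => (i : ℝ≥0) / (N + 1)) fun i j hij => by
    dsimp only; gcongr

lemma hasLaw_brownian_grid (hW : IsPreBrownianReal W P) (N i : ℕ) :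
    HasLaw (fun ω => W (((i + 1 : ℕ) : ℝ≥0) / (N + 1)) ω - W ((i : ℝ≥0) / (N + 1)) ω)
      (gaussianReal 0 (1 / (N + 1))) P := by
  have h := hW.hasLaw_sub (((i + 1 : ℕ) : ℝ≥0) / (N + 1)) ((i : ℝ≥0) / (N + 1))
  convert h using 2
  · rfl
  rw [← NNReal.coe_inj, coe_nndist, Real.dist_eq]
  change _ = |(((((i + 1 : ℕ) : ℝ≥0) / (N + 1) : ℝ≥0)) : ℝ) - (((i : ℝ≥0) / (N + 1) : ℝ≥0) : ℝ)|
  push_cast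
  rw [← sub_div, add_sub_cancel_left, abs_of_pos (by positivity)]

/-- Here the implicit form pays off: with q = β/(N + 1), the gap (1 + q)²s - s - γ²/(N + 1) at s =
γ²/(2β) is q²s ≥ 0. So the stationary variance of the continuous process bounds every scheme, with
no discretisation error. -/
lemma ouEuler_stationary_variance (hβ : 0 < β) (γ : ℝ) (N : ℕ) :
    ((1 + β / (N + 1))⁻¹) ^ 2 * ((Real.toNNReal (γ ^ 2 / (2 * β)) : ℝ)
      + γ ^ 2 * ((1 / (N + 1) : ℝ≥0) : ℝ)) ≤ (Real.toNNReal (γ ^ 2 / (2 * β)) : ℝ) := by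
  rw [Real.coe_toNNReal _ (by positivity)]
  push_cast
  have hN : (0 : ℝ) < N + 1 := by positivity
  rw [inv_pow, inv_mul_le_iff₀ (by positivity)]
  have h : (1 + β / (N + 1 : ℝ)) ^ 2 * (γ ^ 2 / (2 * β)) - (γ ^ 2 / (2 * β) + γ ^ 2 * (1 / (N + 1)))
      = (β / (N + 1)) ^ 2 * (γ ^ 2 / (2 * β)) := by
    field_simp
    ring
  have : 0 ≤ (β / (N + 1 : ℝ)) ^ 2 * (γ ^ 2 / (2 * β)) := by positivity
  linarith

lemma aemeasurable_ouEuler (hW : IsPreBrownianReal W P) (β γ : ℝ) (N k : ℕ) :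
    AEMeasurable (fun ω => ouEuler β γ (fun t => W t ω) N k) P :=
  aemeasurable_arOne (fun i => (hasLaw_brownian_grid hW N i).aemeasurable) k

/-- The bound is uniform in N: 1 - a is of order 1/(N + 1), which together with the (N + 1)T
summands cancels the factor (N + 1)⁻². -/
lemma lintegral_ouEuler_le [IsProbabilityMeasure P] (hW : IsPreBrownianReal W P) (hβ : 0 < β)
    (γ : ℝ) (N T : ℕ) :
    ∫⁻ ω, ENNReal.ofReal (max ((N + 1 : ℝ)⁻¹ * ∑ k ∈ Finset.range ((N + 1) * T),
        |ouEuler β γ (fun t => W t ω) N k| - |γ| / √(Real.pi * β) * T) 0 ^ 2) ∂P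
      ≤ ENNReal.ofReal (3 * γ ^ 2 / β * (1 / β + 1) * T) := by
  have hi := iIndepFun_brownian_grid hW N
  have hl := hasLaw_brownian_grid hW N
  have hs := ouEuler_stationary_variance hβ γ N
  have hN : (0 : ℝ) < N + 1 := by positivity
  have ha : 0 ≤ (1 + β / (N + 1 : ℝ))⁻¹ := by positivity
  have ha1 : (1 + β / (N + 1 : ℝ))⁻¹ < 1 := by
    apply inv_lt_one_of_one_lt₀
    have : 0 < β / (N + 1 : ℝ) := by positivity
    linarith
  have hm : ∀ k, MemLp (fun ω => |ouEuler β γ (fun t => W t ω) N k|) 2 P := fun k =>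
    (memLp_arOne hl k).fun_abs
  have hsum : MemLp (fun ω => ∑ k ∈ Finset.range ((N + 1) * T),
      |ouEuler β γ (fun t => W t ω) N k|) 2 P := memLp_finsetSum _ fun k _ => hm k
  refine lintegral_sq_posPart_sub_le (hsum.const_mul _) ?_ ?_
  · rw [integral_const_mul, integral_finsetSum _ fun k _ => (hm k).integrable one_le_two]
    have hE : √(2 * (Real.toNNReal (γ ^ 2 / (2 * β)) : ℝ) / Real.pi) = |γ| / √(Real.pi * β) := by
      rw [Real.coe_toNNReal _ (by positivity), ← Real.sqrt_sq_eq_abs, ← Real.sqrt_div (sq_nonneg _)]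
      congr 1
      field_simp
    calc _ ≤ (N + 1 : ℝ)⁻¹ * ∑ k ∈ Finset.range ((N + 1) * T), |γ| / √(Real.pi * β) := by
          gcongr with k
          exact hE ▸ integral_abs_arOne_le hi hl hs k
      _ = _ := by
          rw [Finset.sum_const, Finset.card_range, nsmul_eq_mul]
          push_cast
          field_simp
  · rw [variance_const_mul]
    have h := variance_sum_abs_arOne_le hi hl ha ha1 hs ((N + 1) * T)
    calc _ ≤ ((N + 1 : ℝ)⁻¹) ^ 2 * _ := by
          refine mul_le_mul_of_nonneg_left h (sq_nonneg _)
      _ = 3 * γ ^ 2 / β * (1 / β + 1 / (N + 1)) * T := by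
          rw [Real.coe_toNNReal _ (by positivity)]
          have h1 : 1 - (1 + β / (N + 1 : ℝ))⁻¹ = β / (N + 1 + β) := by
            field_simp; ring
          rw [h1]
          push_cast
          field_simp
          ring
      _ ≤ _ := by
          gcongr
          rw [div_le_one hN]
          linarith [(Nat.cast_nonneg N : (0 : ℝ) ≤ N)]

/-- If the Riemann sums of the implicit Euler schemes converge to `A T` for every integer `T`,
then `A (n ^ 2)` eventually stays below any slope larger than the stationary first moment. -/
lemma ae_eventually_lt_of_tendsto_ouEuler [IsProbabilityMeasure P] (hW : IsPreBrownianReal W P)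
    (hβ : 0 < β) (γ : ℝ) {A : ℕ → Ω → ℝ}
    (hA : ∀ T : ℕ, ∀ᵐ ω ∂P, Tendsto (fun N : ℕ => (N + 1 : ℝ)⁻¹ *
      ∑ k ∈ Finset.range ((N + 1) * T), |ouEuler β γ (fun t => W t ω) N k|) atTop (𝓝 (A T ω)))
    {δ : ℝ} (hδ : 0 < δ) :
    ∀ᵐ ω ∂P, ∀ᶠ n : ℕ in atTop,
      A (n ^ 2) ω < (|γ| / √(Real.pi * β) + δ) * (n ^ 2 : ℕ) := by
  set m := |γ| / √(Real.pi * β)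
  set C := 3 * γ ^ 2 / β * (1 / β + 1)
  have hC : 0 ≤ C := by positivity
  -- At T = n² the bound CT/(δT)² is C/(δ²n²), hence summable; n = 0 is excluded as the deviation
  -- must be positive.
  have hb : ∀ n : ℕ, P {ω | n ≠ 0 ∧ (m + δ) * (n ^ 2 : ℕ) ≤ A (n ^ 2) ω}
      ≤ ENNReal.ofReal (C / δ ^ 2 * (1 / (n : ℝ) ^ 2)) := by
    intro n
    by_cases hn : n = 0
    · simp [hn]
    have hn' : (0 : ℝ) < n := by positivity
    have h := measure_ge_le_of_tendsto (d := δ * (n ^ 2 : ℕ)) (by positivity)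
      (fun N => (Finset.aemeasurable_fun_sum _ fun k _ =>
        (aemeasurable_ouEuler hW β γ N k).abs).const_mul (N + 1 : ℝ)⁻¹)
      (fun N => lintegral_ouEuler_le hW hβ γ N (n ^ 2)) (hA (n ^ 2))
    convert h using 2
    · ext ω; simp only [Set.mem_ofPred_eq, ne_eq, hn, not_false_eq_true, true_and, add_mul]; rfl
    · simp only [C]; push_cast; field_simp
  have hsum : ∑' n : ℕ, P {ω | n ≠ 0 ∧ (m + δ) * (n ^ 2 : ℕ) ≤ A (n ^ 2) ω} ≠ ∞ := by
    refine ne_top_of_le_ne_top ?_ (ENNReal.tsum_le_tsum hb)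
    exact ((Real.summable_one_div_nat_pow.2 one_lt_two).mul_left _).tsum_ofReal_ne_top
  filter_upwards [ae_eventually_notMem hsum] with ω hω
  filter_upwards [hω, eventually_ne_atTop 0] with n hn hn0
  by_contra! h
  exact hn ⟨hn0, h⟩

end OrnsteinUhlenbeck

/-! ### Pathwise convergence of the scheme. -/

lemma toNNReal_natCast_div (k N : ℕ) :
    Real.toNNReal ((k : ℝ) / (N + 1)) = (k : ℝ≥0) / (N + 1) := by
  rw [← NNReal.coe_inj, Real.coe_toNNReal _ (by positivity)]
  push_cast
  rfl

/-- The implicit Euler scheme follows the Ornstein-Uhlenbeck path up to its oscillation. -/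
lemma abs_sub_ouEuler_le {β γ ε : ℝ} (hβ : 0 < β) {w : ℝ≥0 → ℝ} {Z : ℝ → ℝ} (hZc : Continuous Z)
    (hZ : ∀ t, 0 ≤ t → Z t = (∫ s in (0 : ℝ)..t, -β * Z s) + γ * (w t.toNNReal - w 0))
    {T N : ℕ} (hε : 0 ≤ ε) (hosc : ∀ s ∈ Set.Icc (0 : ℝ) T, ∀ t ∈ Set.Icc (0 : ℝ) T,
      |s - t| ≤ 1 / (N + 1) → |Z s - Z t| ≤ ε) (k : ℕ) (hk : k ≤ (N + 1) * T) :
    |Z (k / (N + 1)) - ouEuler β γ w N k| ≤ ε := by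
  have hN : (0 : ℝ) < N + 1 := by positivity
  induction k with
  | zero => simpa [hZ 0 le_rfl, ouEuler, arOne] using hε
  | succ k ih =>
    specialize ih (by omega)
    set S := ouEuler β γ w N k with hS
    set dw := w (((k + 1 : ℕ) : ℝ≥0) / (N + 1)) - w ((k : ℝ≥0) / (N + 1)) with hdw
    set q := β / (N + 1 : ℝ) with hq
    have hq0 : 0 < q := by positivity
    have hrec : ouEuler β γ w N (k + 1) = (1 + q)⁻¹ * (S + γ * dw) := rfl
    set s₀ : ℝ := (k : ℝ) / (N + 1) with hs₀
    set s₁ : ℝ := ((k + 1 : ℕ) : ℝ) / (N + 1) with hs₁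
    have hdiff : s₁ - s₀ = 1 / (N + 1) := by rw [hs₁, hs₀]; push_cast; ring
    have h01 : s₀ ≤ s₁ := by
      have : 0 < 1 / (N + 1 : ℝ) := by positivity
      linarith
    have hs0 : 0 ≤ s₀ := by positivity
    have hs1T : s₁ ≤ T := by
      rw [hs₁, div_le_iff₀ hN, mul_comm]
      exact_mod_cast hk
    have hint : ∀ a b, IntervalIntegrable (fun s => -β * Z s) volume a b := fun a b =>
      (by fun_prop : Continuous fun s => -β * Z s).intervalIntegrable a b
    have hstep : Z s₁ - Z s₀ = (∫ s in s₀..s₁, -β * Z s) + γ * dw := by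
      rw [hZ s₁ (hs0.trans h01), hZ s₀ hs0,
        ← intervalIntegral.integral_add_adjacent_intervals (hint 0 s₀) (hint s₀ s₁), hs₁, hs₀,
        toNNReal_natCast_div, toNNReal_natCast_div]
      ring
    -- Freezing Z at the right endpoint reproduces the implicit step.
    have hI : ∫ s in s₀..s₁, -β * Z s = -q * Z s₁ + ∫ s in s₀..s₁, β * (Z s₁ - Z s) := by
      have : ∀ s, β * (Z s₁ - Z s) = β * Z s₁ + -β * Z s := fun s => by ring
      simp_rw [this]
      rw [intervalIntegral.integral_add (by simp) (hint _ _), intervalIntegral.integral_const,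
        hdiff, smul_eq_mul, hq]
      ring
    have hE : |∫ s in s₀..s₁, β * (Z s₁ - Z s)| ≤ q * ε := by
      have h := intervalIntegral.norm_integral_le_of_norm_le_const (a := s₀) (b := s₁)
        (f := fun s => β * (Z s₁ - Z s)) (C := β * ε) (fun s hs => by
          rw [Set.uIoc_of_le h01] at hs
          rw [norm_mul, Real.norm_of_nonneg hβ.le]
          gcongr
          refine hosc s₁ ⟨hs0.trans h01, hs1T⟩ s ⟨hs0.trans hs.1.le, hs.2.trans hs1T⟩ ?_
          rw [abs_of_nonneg (by linarith [hs.2])]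
          linarith [hs.1])
      rw [hdiff, abs_of_pos (by positivity), Real.norm_eq_abs] at h
      convert h using 1
      rw [hq]; ring
    have key : Z s₁ - ouEuler β γ w N (k + 1)
        = (1 + q)⁻¹ * ((Z s₀ - S) + ∫ s in s₀..s₁, β * (Z s₁ - Z s)) := by
      rw [hrec]
      have : (1 + q) * Z s₁ = Z s₀ + (∫ s in s₀..s₁, β * (Z s₁ - Z s)) + γ * dw := by
        linarith
      have h1q : 1 + q ≠ 0 := by positivity
      field_simp
      linarith
    -- The error map e ↦ (e + qε)/(1 + q) fixes ε, so errors do not accumulate.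
    rw [key, abs_mul, abs_of_pos (by positivity), inv_mul_le_iff₀ (by positivity)]
    calc _ ≤ |Z s₀ - S| + |∫ s in s₀..s₁, β * (Z s₁ - Z s)| := abs_add_le _ _
      _ ≤ ε + q * ε := by gcongr
      _ = _ := by ring

lemma tendsto_riemannSum_ouEuler {β γ : ℝ} (hβ : 0 < β) {w : ℝ≥0 → ℝ} {Z : ℝ → ℝ}
    (hZc : Continuous Z)
    (hZ : ∀ t, 0 ≤ t → Z t = (∫ s in (0 : ℝ)..t, -β * Z s) + γ * (w t.toNNReal - w 0)) (T : ℕ) :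
    Tendsto (fun N : ℕ => (N + 1 : ℝ)⁻¹ *
      ∑ k ∈ Finset.range ((N + 1) * T), |ouEuler β γ w N k|) atTop
      (𝓝 (∫ s in (0 : ℝ)..T, |Z s|)) := by
  rw [Metric.tendsto_atTop]
  intro ε' hε'
  -- The cells contribute 2Tε in all; the extra 1 makes the inequality strict and covers T = 0.
  set ε := ε' / (2 * T + 1) with hεdef
  have hε : 0 < ε := by positivity
  have huc := isCompact_Icc.uniformContinuousOn_of_continuous
    (hZc.continuousOn (s := Set.Icc (0 : ℝ) T))
  rw [Metric.uniformContinuousOn_iff_le] at huc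
  obtain ⟨d, hd, hd'⟩ := huc ε hε
  obtain ⟨N₀, hN₀⟩ := exists_nat_one_div_lt hd
  refine ⟨N₀, fun N hN => ?_⟩
  have hN0 : (0 : ℝ) < N + 1 := by positivity
  have hNd : 1 / (N + 1 : ℝ) ≤ d := by
    refine le_trans ?_ hN₀.le
    gcongr
  have hosc : ∀ s ∈ Set.Icc (0 : ℝ) T, ∀ t ∈ Set.Icc (0 : ℝ) T,
      |s - t| ≤ 1 / (N + 1) → |Z s - Z t| ≤ ε := fun s hs t ht hst =>
    hd' s hs t ht (hst.trans hNd)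
  have happ := abs_sub_ouEuler_le hβ hZc hZ hε.le hosc
  have hint : ∀ a b, IntervalIntegrable (fun s => |Z s|) volume a b := fun a b =>
    hZc.abs.intervalIntegrable a b
  have hsplit : ∫ s in (0 : ℝ)..T, |Z s| = ∑ k ∈ Finset.range ((N + 1) * T),
      ∫ s in ((k : ℝ) / (N + 1))..(((k + 1 : ℕ) : ℝ) / (N + 1)), |Z s| := by
    rw [intervalIntegral.sum_integral_adjacent_intervals (a := fun k : ℕ => (k : ℝ) / (N + 1))
      fun k _ => hint _ _]
    congr 1
    · simp
    · push_cast; field_simp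
  rw [hsplit, Finset.mul_sum, Real.dist_eq, ← Finset.sum_sub_distrib]
  have hterm : ∀ k ∈ Finset.range ((N + 1) * T), |(N + 1 : ℝ)⁻¹ * |ouEuler β γ w N k|
      - (∫ s in ((k : ℝ) / (N + 1))..(((k + 1 : ℕ) : ℝ) / (N + 1)), |Z s|)|
        ≤ 2 * ε * (N + 1 : ℝ)⁻¹ := by
    intro k hk
    have hk' : k + 1 ≤ (N + 1) * T := Finset.mem_range.1 hk
    set s₀ : ℝ := (k : ℝ) / (N + 1) with hs₀
    set s₁ : ℝ := ((k + 1 : ℕ) : ℝ) / (N + 1) with hs₁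
    have hdiff : s₁ - s₀ = (N + 1 : ℝ)⁻¹ := by rw [hs₁, hs₀]; push_cast; ring
    have h01 : s₀ ≤ s₁ := by
      have : 0 < (N + 1 : ℝ)⁻¹ := by positivity
      linarith
    have hs0 : 0 ≤ s₀ := by positivity
    have hs1T : s₁ ≤ T := by
      rw [hs₁, div_le_iff₀ hN0, mul_comm]
      exact_mod_cast hk'
    have hconst : (N + 1 : ℝ)⁻¹ * |ouEuler β γ w N k| = ∫ _ in s₀..s₁, |ouEuler β γ w N k| := by
      rw [intervalIntegral.integral_const, hdiff, smul_eq_mul]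
    rw [hconst, ← intervalIntegral.integral_sub (by simp) (hint _ _)]
    have h := intervalIntegral.norm_integral_le_of_norm_le_const (a := s₀) (b := s₁)
      (f := fun s => |ouEuler β γ w N k| - |Z s|) (C := 2 * ε) (fun s hs => by
        rw [Set.uIoc_of_le h01] at hs
        have h1 := happ k (by omega)
        have h2 := hosc s₀ ⟨hs0, h01.trans hs1T⟩ s ⟨hs0.trans hs.1.le, hs.2.trans hs1T⟩ (by
          rw [abs_sub_comm, abs_of_nonneg (by linarith [hs.1]), one_div]
          linarith [hs.2])
        rw [abs_sub_comm] at h1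
        calc _ ≤ |ouEuler β γ w N k - Z s| := abs_abs_sub_abs_le _ _
          _ ≤ |ouEuler β γ w N k - Z s₀| + |Z s₀ - Z s| := abs_sub_le _ _ _
          _ ≤ 2 * ε := by linarith)
    rwa [hdiff, abs_of_pos (a := (N + 1 : ℝ)⁻¹) (by positivity), Real.norm_eq_abs] at h
  calc _ ≤ _ := Finset.abs_sum_le_sum_abs _ _
    _ ≤ _ := Finset.sum_le_sum hterm
    _ = 2 * T * ε := by
      rw [Finset.sum_const, Finset.card_range, nsmul_eq_mul]; push_cast; field_simp
    _ < (2 * T + 1) * ε := by linarith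
    _ = ε' := by rw [hεdef]; field_simp

/-! ### Growth along squares and Gronwall estimates. -/

/-- A monotone function with slope at most `c` along the squares grows at most like
`C + c' t` for each `c' > c`. -/
lemma exists_le_add_mul_of_eventually_sq {A : ℝ → ℝ} (hA : MonotoneOn A (Set.Ici 0))
    {c c' : ℝ} (hc : 0 ≤ c) (hcc : c < c')
    (h : ∀ᶠ n : ℕ in atTop, A ((n ^ 2 : ℕ) : ℝ) < c * (n ^ 2 : ℕ)) :
    ∃ C : ℕ, ∀ t, 0 ≤ t → A t ≤ C + c' * t := by
  obtain ⟨n₀, hn₀⟩ := eventually_atTop.1 h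
  have hc' : 0 < c' := hc.trans_lt hcc
  -- `c (n + 1)² ≤ D + c' n²` for all `n`
  set D := c * (c + c') / (c' - c) + c + c with hD
  have hD1 : ∀ n : ℕ, c * ((n : ℝ) + 1) ^ 2 ≤ D + c' * (n : ℝ) ^ 2 := by
    intro n
    have hpos : 0 < c' - c := by linarith
    have h2 : 2 * c * (n : ℝ) ≤ (c' - c) * n ^ 2 + c ^ 2 / (c' - c) := by
      have : (c' - c) * (n : ℝ) ^ 2 + c ^ 2 / (c' - c) - 2 * c * n
          = (c' - c) * (n - c / (c' - c)) ^ 2 := by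
        field_simp; ring
      have h3 : 0 ≤ (c' - c) * ((n : ℝ) - c / (c' - c)) ^ 2 := by positivity
      linarith
    have h3 : c ^ 2 / (c' - c) ≤ c * (c + c') / (c' - c) := by
      gcongr
      nlinarith
    nlinarith
  obtain ⟨C, hC⟩ := exists_nat_ge (max D (A ((n₀ ^ 2 : ℕ) : ℝ)))
  refine ⟨C, fun t ht => ?_⟩
  have hCD := (le_max_left _ _).trans hC
  have hCA := (le_max_right _ _).trans hC
  by_cases htn : t ≤ ((n₀ ^ 2 : ℕ) : ℝ)
  · have := hA ht (ht.trans htn) htn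
    have : 0 ≤ c' * t := by positivity
    linarith
  push Not at htn
  -- As n² ≤ t ≤ (n + 1)², monotonicity gives A t ≤ c(n + 1)² ≤ D + c'n² ≤ D + c't.
  set n := ⌊√t⌋₊ with hn
  have hn1 : (n : ℝ) ≤ √t := Nat.floor_le (Real.sqrt_nonneg t)
  have hn2 : √t < n + 1 := Nat.lt_floor_add_one _
  have hsq : √t ^ 2 = t := Real.sq_sqrt ht
  have hn3 : (n : ℝ) ^ 2 ≤ t := by rw [← hsq]; gcongr
  have hn4 : t ≤ ((n : ℝ) + 1) ^ 2 := by rw [← hsq]; gcongr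
  have hn5 : n₀ ≤ n + 1 := by
    have : (n₀ : ℝ) ≤ √t := Real.le_sqrt_of_sq_le (by exact_mod_cast htn.le)
    exact_mod_cast (this.trans hn2.le)
  have h1 := hn₀ (n + 1) hn5
  push_cast at h1
  have h2 := hA ht (ht.trans hn4) hn4
  have h3 := hD1 n
  have h4 : c' * (n : ℝ) ^ 2 ≤ c' * t := by gcongr
  linarith

lemma hasDerivAt_of_eq_add_integral {F f : ℝ → ℝ} (hf : Continuous f) {c : ℝ}
    (h : ∀ t, 0 ≤ t → F t = c + ∫ s in (0 : ℝ)..t, f s) {t : ℝ} (ht : 0 < t) :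
    HasDerivAt F (f t) t := by
  refine ((intervalIntegral.integral_hasDerivAt_right (hf.intervalIntegrable 0 t)
    (hf.stronglyMeasurableAtFilter _ _) hf.continuousAt).const_add c).congr_of_eventuallyEq ?_
  filter_upwards [lt_mem_nhds ht] with s hs using h s hs.le

/-- A Gronwall inequality with a time-dependent rate. -/
lemma le_mul_exp_of_hasDerivAt_le {V V' θ : ℝ → ℝ} (hV : Continuous V) (hθ : Continuous θ)
    (hd : ∀ t, 0 < t → HasDerivAt V (V' t) t) (hle : ∀ t, 0 < t → V' t ≤ θ t * V t)
    {t : ℝ} (ht : 0 ≤ t) : V t ≤ V 0 * Real.exp (∫ s in (0 : ℝ)..t, θ s) := by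
  have hI : ∀ t, HasDerivAt (fun t => ∫ s in (0 : ℝ)..t, θ s) (θ t) t := fun t =>
    intervalIntegral.integral_hasDerivAt_right (hθ.intervalIntegrable 0 t)
      (hθ.stronglyMeasurableAtFilter _ _) hθ.continuousAt
  have hE : ∀ t, HasDerivAt (fun t => Real.exp (-∫ s in (0 : ℝ)..t, θ s))
      (Real.exp (-∫ s in (0 : ℝ)..t, θ s) * -θ t) t := fun t => (hI t).fun_neg.exp
  have hG : AntitoneOn (fun t => V t * Real.exp (-∫ s in (0 : ℝ)..t, θ s)) (Set.Ici 0) := by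
    refine antitoneOn_of_hasDerivWithinAt_nonpos (convex_Ici 0)
      (f' := fun t => V' t * Real.exp (-∫ s in (0 : ℝ)..t, θ s)
        + V t * (Real.exp (-∫ s in (0 : ℝ)..t, θ s) * -θ t)) ?_ ?_ ?_
    · exact (hV.mul (continuous_iff_continuousAt.2 fun t => (hE t).continuousAt)).continuousOn
    · intro t ht
      rw [interior_Ici] at ht
      exact ((hd t ht).mul (hE t)).hasDerivWithinAt
    · intro t ht
      rw [interior_Ici] at ht
      have h1 := hle t ht
      have h2 := Real.exp_pos (-∫ s in (0 : ℝ)..t, θ s)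
      nlinarith
  have h := hG Set.self_mem_Ici ht ht
  simp only [intervalIntegral.integral_same, neg_zero, Real.exp_zero, mul_one] at h
  rw [Real.exp_neg, ← div_eq_mul_inv, div_le_iff₀ (Real.exp_pos _)] at h
  exact h

/-! ### Transverse Lyapunov function. -/

/-- The coordinates `X`, `Y`, `Z` solve the Lorenz 63 system on `[0, ∞)`, the third equation being
forced by `f`. -/
structure IsLorenzPath (σ ρ β : ℝ) (f X Y Z : ℝ → ℝ) : Prop where
  continuous_x : Continuous X
  continuous_y : Continuous Y
  continuous_z : Continuous Z
  eq_x : ∀ t, 0 ≤ t → X t = X 0 + ∫ s in (0 : ℝ)..t, σ * (Y s - X s)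
  eq_y : ∀ t, 0 ≤ t → Y t = Y 0 + ∫ s in (0 : ℝ)..t, (ρ * X s - Y s - X s * Z s)
  eq_z : ∀ t, 0 ≤ t → Z t = Z 0 + (∫ s in (0 : ℝ)..t, (-β * Z s + X s * Y s)) + f t

/-- A Lyapunov function for the first two coordinates of the Lorenz 63 system. -/
def lorenzLyapunov (σ x y : ℝ) : ℝ := (x + σ * y) ^ 2 + σ ^ 2 * (x - y) ^ 2

lemma lorenzLyapunov_nonneg (σ x y : ℝ) : 0 ≤ lorenzLyapunov σ x y := by
  unfold lorenzLyapunov; positivity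

lemma sq_add_sq_le_lorenzLyapunov {σ : ℝ} (hσ : 0 < σ) (x y : ℝ) :
    x ^ 2 + y ^ 2 ≤ (4 + 2 / σ ^ 2) * lorenzLyapunov σ x y := by
  set p := x + σ * y with hp
  set q := x - y with hq
  have hx : x = (p + σ * q) / (1 + σ) := by rw [hp, hq]; field_simp; ring
  have hy : y = (p - q) / (1 + σ) := by rw [hp, hq]; field_simp; ring
  have h1 : x ^ 2 ≤ (p + σ * q) ^ 2 := by
    rw [hx, div_pow]
    exact div_le_self (sq_nonneg _) (by nlinarith)
  have h2 : y ^ 2 ≤ (p - q) ^ 2 := by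
    rw [hy, div_pow]
    exact div_le_self (sq_nonneg _) (by nlinarith)
  have h3 : (4 + 2 / σ ^ 2) * lorenzLyapunov σ x y
      = 4 * p ^ 2 + 4 * (σ * q) ^ 2 + 2 * q ^ 2 + 2 / σ ^ 2 * p ^ 2 := by
    rw [lorenzLyapunov, ← hp, ← hq]; field_simp; ring
  have h4 : 0 ≤ 2 / σ ^ 2 * p ^ 2 := by positivity
  rw [h3]
  nlinarith [sq_nonneg (p - σ * q), sq_nonneg (p + q)]

lemma lorenzLyapunov_le (σ x y : ℝ) :
    lorenzLyapunov σ x y ≤ (2 + 4 * σ ^ 2) * (x ^ 2 + y ^ 2) := by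
  unfold lorenzLyapunov
  nlinarith [sq_nonneg (x - σ * y), mul_nonneg (sq_nonneg σ) (sq_nonneg (x + y)),
    mul_nonneg (sq_nonneg σ) (sq_nonneg x), sq_nonneg y]

/-- In p = x + σy and q = x - y, the weight σ² on q² cancels the cross terms. The rates left are κ(ρ
- 1 - z) for p and -(1 + σ) - κ(ρ - 1 - z) for q. The latter obeys the same bound because ρ ≥ -1 and
4κ ≤ 1 + σ. -/
lemma lorenzLyapunov_deriv_le {σ ρ : ℝ} (hσ : 0 < σ) (hρ : -1 ≤ ρ) (x y z : ℝ) :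
    2 * (x + σ * y) * (σ * (y - x) + σ * (ρ * x - y - x * z))
      + σ ^ 2 * (2 * (x - y) * (σ * (y - x) - (ρ * x - y - x * z)))
    ≤ 2 * (σ / (1 + σ)) * (ρ - 1 + |z|) * lorenzLyapunov σ x y := by
  set p := x + σ * y with hp
  set q := x - y with hq
  set κ := σ / (1 + σ) with hκ
  have hκ0 : 0 < κ := by positivity
  have hz1 := neg_abs_le z
  have hz2 := le_abs_self z
  have h4κ : 4 * κ ≤ 1 + σ := by
    rw [hκ, ← mul_div_assoc, div_le_iff₀ (by positivity)]
    nlinarith [sq_nonneg (1 - σ)]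
  have hlhs : 2 * p * (σ * (y - x) + σ * (ρ * x - y - x * z))
      + σ ^ 2 * (2 * q * (σ * (y - x) - (ρ * x - y - x * z)))
      = 2 * (κ * (ρ - z - 1)) * p ^ 2
        + 2 * (-(1 + σ) - κ * (ρ - z - 1)) * (σ ^ 2 * q ^ 2) := by
    rw [hp, hq, hκ]; field_simp; ring
  have h1 : κ * (ρ - z - 1) ≤ κ * (ρ - 1 + |z|) := by gcongr; linarith
  have h2 : -(1 + σ) - κ * (ρ - z - 1) ≤ κ * (ρ - 1 + |z|) := by nlinarith
  have e1 := mul_le_mul_of_nonneg_right h1 (sq_nonneg p)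
  have e2 := mul_le_mul_of_nonneg_right h2 (by positivity : 0 ≤ σ ^ 2 * q ^ 2)
  rw [hlhs, lorenzLyapunov, ← hp, ← hq]
  linarith

namespace IsLorenzPath

variable {σ ρ β : ℝ} {f X Y Z : ℝ → ℝ}

lemma lyapunov_le (h : IsLorenzPath σ ρ β f X Y Z) (hσ : 0 < σ) (hρ : -1 ≤ ρ) {t : ℝ}
    (ht : 0 ≤ t) : lorenzLyapunov σ (X t) (Y t) ≤ lorenzLyapunov σ (X 0) (Y 0)
      * Real.exp (∫ s in (0 : ℝ)..t, 2 * (σ / (1 + σ)) * (ρ - 1 + |Z s|)) := by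
  have cX := h.continuous_x
  have cY := h.continuous_y
  have cZ := h.continuous_z
  have dX : ∀ t, 0 < t → HasDerivAt X _ t := fun t ht =>
    hasDerivAt_of_eq_add_integral (by fun_prop) h.eq_x ht
  have dY : ∀ t, 0 < t → HasDerivAt Y _ t := fun t ht =>
    hasDerivAt_of_eq_add_integral (by fun_prop) h.eq_y ht
  refine le_mul_exp_of_hasDerivAt_le (V := fun t => lorenzLyapunov σ (X t) (Y t))
    (by unfold lorenzLyapunov; fun_prop) (by fun_prop) (fun t ht => ?_)
    (fun t _ => lorenzLyapunov_deriv_le hσ hρ (X t) (Y t) (Z t)) ht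
  have d1 := (((dX t ht).add ((dY t ht).const_mul σ)).pow 2).add
    ((((dX t ht).sub (dY t ht)).pow 2).const_mul (σ ^ 2))
  refine d1.congr_deriv ?_
  simp

/-- The `z`-axis is invariant. -/
lemma eq_zero_of_eq_zero (h : IsLorenzPath σ ρ β f X Y Z) (hσ : 0 < σ) (hρ : -1 ≤ ρ)
    (hX : X 0 = 0) (hY : Y 0 = 0) {t : ℝ} (ht : 0 ≤ t) : X t = 0 ∧ Y t = 0 := by
  have h1 := h.lyapunov_le hσ hρ ht
  have h2 := sq_add_sq_le_lorenzLyapunov hσ (X t) (Y t)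
  have h3 : lorenzLyapunov σ (X t) (Y t) = 0 := by
    refine le_antisymm (h1.trans_eq ?_) (lorenzLyapunov_nonneg _ _ _)
    rw [hX, hY]
    simp [lorenzLyapunov]
  rw [h3, mul_zero] at h2
  constructor <;> nlinarith [sq_nonneg (X t), sq_nonneg (Y t)]

end IsLorenzPath

/-! ### Exponential attraction to the axis solution. -/

/-- The function F e^{βt} - B e^{(β - r)t} decreases once K ≤ B(β - r); r ≤ β/2 makes the summand
2K/β of B large enough. -/
lemma le_exp_of_linear_ode {F g : ℝ → ℝ} {β r K T : ℝ} (hβ : 0 < β) (hr : r ≤ β / 2) (hK : 0 ≤ K)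
    (hF : Continuous F) (hd : ∀ t, 0 < t → HasDerivAt F (-β * F t + g t) t)
    (hg : ∀ t ∈ Set.Icc 0 T, g t ≤ K * Real.exp (-r * t)) {t : ℝ} (ht : t ∈ Set.Icc 0 T) :
    F t ≤ (|F 0| + 2 * K / β) * Real.exp (-r * t) := by
  set B := |F 0| + 2 * K / β with hB
  have hKB : K ≤ B * (β - r) := by
    have h1 : 0 ≤ |F 0| := abs_nonneg _
    have h2 : 2 * K / β * (β / 2) = K := by field_simp
    have h3 : 0 ≤ 2 * K / β := by positivity
    nlinarith
  have hG : AntitoneOn (fun t => F t * Real.exp (β * t) - B * Real.exp ((β - r) * t))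
      (Set.Icc 0 T) := by
    have dE : ∀ c t : ℝ, HasDerivAt (fun t => Real.exp (c * t)) (Real.exp (c * t) * c) t :=
      fun c t => by simpa using ((hasDerivAt_id t).const_mul c).exp
    refine antitoneOn_of_hasDerivWithinAt_nonpos (convex_Icc 0 T)
      (f' := fun t => (-β * F t + g t) * Real.exp (β * t) + F t * (Real.exp (β * t) * β)
        - B * (Real.exp ((β - r) * t) * (β - r))) (by fun_prop) ?_ ?_
    · intro t ht
      rw [interior_Icc] at ht
      exact (((hd t ht.1).mul (dE β t)).sub ((dE (β - r) t).const_mul B)).hasDerivWithinAt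
    · intro t ht
      have h1 := hg t (interior_subset ht)
      have h2 : Real.exp ((β - r) * t) = Real.exp (-r * t) * Real.exp (β * t) := by
        rw [← Real.exp_add]; ring_nf
      rw [h2]
      have h3 := Real.exp_pos (β * t)
      have h4 := Real.exp_pos (-r * t)
      have h5 : g t ≤ B * (β - r) * Real.exp (-r * t) := h1.trans (by gcongr)
      nlinarith [mul_le_mul_of_nonneg_right h5 h3.le]
  have h := hG (Set.left_mem_Icc.2 (ht.1.trans ht.2)) ht ht.1
  simp only [mul_zero, Real.exp_zero, mul_one] at h
  have h0 : F 0 - B ≤ 0 := by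
    have h1 := le_abs_self (F 0)
    have h3 : 0 ≤ 2 * K / β := by positivity
    linarith
  have h2 : Real.exp ((β - r) * t) = Real.exp (-r * t) * Real.exp (β * t) := by
    rw [← Real.exp_add]; ring_nf
  rw [h2] at h
  have h3 := Real.exp_pos (β * t)
  refine le_of_mul_le_mul_right ?_ h3
  linarith

lemma abs_le_exp_of_linear_ode {F g : ℝ → ℝ} {β r K T : ℝ} (hβ : 0 < β) (hr : r ≤ β / 2)
    (hK : 0 ≤ K) (hF : Continuous F) (hd : ∀ t, 0 < t → HasDerivAt F (-β * F t + g t) t)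
    (hg : ∀ t ∈ Set.Icc 0 T, |g t| ≤ K * Real.exp (-r * t)) {t : ℝ} (ht : t ∈ Set.Icc 0 T) :
    |F t| ≤ (|F 0| + 2 * K / β) * Real.exp (-r * t) := by
  refine abs_le'.2 ⟨le_exp_of_linear_ode hβ hr hK hF hd
    (fun t ht => (le_abs_self _).trans (hg t ht)) ht, ?_⟩
  have h := le_exp_of_linear_ode (F := fun t => -F t) (g := fun t => -g t) hβ hr hK hF.neg
    (fun t ht => (hd t ht).fun_neg.congr_deriv (by ring))
    (fun t ht => (neg_le_abs _).trans (hg t ht)) ht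
  simpa using h

/-- If `|Zs|` has time average below `1 - ρ`, where `Zs` is the solution on the `z`-axis from the
origin, then solutions starting close to the origin converge to it exponentially fast. -/
lemma IsLorenzPath.exp_decay {σ ρ β : ℝ} {f X Y Z Zs : ℝ → ℝ}
    (h : IsLorenzPath σ ρ β f X Y Z) (hσ : 0 < σ) (hβ : 0 < β) (hρ : -1 ≤ ρ)
    (hZs : Continuous Zs)
    (hZs' : ∀ t, 0 ≤ t → Zs t = (∫ s in (0 : ℝ)..t, -β * Zs s) + f t)
    {C η r D : ℝ}
    (hC : ∀ t, 0 ≤ t → ∫ s in (0 : ℝ)..t, |Zs s| ≤ C + (1 - ρ - 2 * η) * t)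
    (hrβ : r ≤ β / 2) (hrη : r ≤ 2 * (σ / (1 + σ)) * η) (hr : 0 ≤ r)
    (hD : lorenzLyapunov σ (X 0) (Y 0) * Real.exp (2 * (σ / (1 + σ)) * C) ≤ D)
    (hDη : |Z 0| + 2 * ((4 + 2 / σ ^ 2) * D) / β < η) {t : ℝ} (ht : 0 ≤ t) :
    lorenzLyapunov σ (X t) (Y t) ≤ D * Real.exp (-r * t)
      ∧ |Z t - Zs t| ≤ η * Real.exp (-r * t) := by
  set κ := σ / (1 + σ) with hκ
  have hκ0 : 0 < κ := by positivity
  have cX := h.continuous_x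
  have cY := h.continuous_y
  have cZ := h.continuous_z
  have hf0 : f 0 = 0 := by simpa using h.eq_z 0 le_rfl
  have hZs0 : Zs 0 = 0 := by simpa [hf0] using hZs' 0 le_rfl
  have hD0 : 0 ≤ D := le_trans (mul_nonneg (lorenzLyapunov_nonneg _ _ _) (Real.exp_pos _).le) hD
  -- First half of the bootstrap: of the margin 2η in `hC`, one η pays for |Z - `Zs`| and the other
  -- gives the decay rate.
  have hV : ∀ T, 0 ≤ T → (∀ s ∈ Set.Icc 0 T, |Z s - Zs s| ≤ η) →
      lorenzLyapunov σ (X T) (Y T) ≤ D * Real.exp (-r * T) := by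
    intro T hT hb
    have hI : ∫ s in (0 : ℝ)..T, 2 * κ * (ρ - 1 + |Z s|) ≤ 2 * κ * C - r * T := by
      have h1 : ∫ s in (0 : ℝ)..T, 2 * κ * (ρ - 1 + |Z s|)
          ≤ ∫ s in (0 : ℝ)..T, 2 * κ * ((ρ - 1 + η) + |Zs s|) := by
        refine intervalIntegral.integral_mono_on hT
          (by apply Continuous.intervalIntegrable; fun_prop)
          (by apply Continuous.intervalIntegrable; fun_prop) fun s hs => ?_
        have h2 := hb s hs
        have h3 : |Z s| ≤ |Z s - Zs s| + |Zs s| := by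
          simpa using abs_add_le (Z s - Zs s) (Zs s)
        gcongr 2 * κ * ?_
        linarith
      rw [intervalIntegral.integral_const_mul, intervalIntegral.integral_const_mul,
        intervalIntegral.integral_add (by simp) (hZs.abs.intervalIntegrable _ _),
        intervalIntegral.integral_const] at h1
      rw [intervalIntegral.integral_const_mul]
      have h4 := hC T hT
      have h5 : 2 * κ * ((T - 0) • (ρ - 1 + η) + ∫ s in (0 : ℝ)..T, |Zs s|)
          ≤ 2 * κ * (C - η * T) := by
        gcongr
        rw [smul_eq_mul]
        linarith
      have h6 : r * T ≤ 2 * κ * η * T := by gcongr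
      linarith
    calc _ ≤ _ := h.lyapunov_le hσ hρ hT
      _ ≤ lorenzLyapunov σ (X 0) (Y 0) * Real.exp (2 * κ * C - r * T) := by
          gcongr
          exact lorenzLyapunov_nonneg _ _ _
      _ = lorenzLyapunov σ (X 0) (Y 0) * Real.exp (2 * κ * C) * Real.exp (-r * T) := by
          rw [mul_assoc (lorenzLyapunov _ _ _), ← Real.exp_add]; ring_nf
      _ ≤ _ := by gcongr
  -- Second half: the noise cancels in the difference.
  have hζeq : ∀ t, 0 ≤ t → Z t - Zs t
      = Z 0 + ∫ s in (0 : ℝ)..t, (-β * (Z s - Zs s) + X s * Y s) := by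
    intro t ht
    have : ∀ s, -β * (Z s - Zs s) + X s * Y s = (-β * Z s + X s * Y s) - -β * Zs s :=
      fun s => by ring
    simp_rw [this]
    rw [intervalIntegral.integral_sub (by apply Continuous.intervalIntegrable; fun_prop)
      (by apply Continuous.intervalIntegrable; fun_prop), h.eq_z t ht, hZs' t ht]
    ring
  have hζ : ∀ T, 0 ≤ T → (∀ s ∈ Set.Icc 0 T, |Z s - Zs s| ≤ η) →
      |Z T - Zs T| ≤ (|Z 0| + 2 * ((4 + 2 / σ ^ 2) * D) / β) * Real.exp (-r * T) := by
    intro T hT hb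
    have h1 := abs_le_exp_of_linear_ode (F := fun t => Z t - Zs t) (g := fun t => X t * Y t)
      (r := r) (K := (4 + 2 / σ ^ 2) * D) (T := T) hβ hrβ (by positivity) (by fun_prop)
      (fun t ht => hasDerivAt_of_eq_add_integral (by fun_prop) hζeq ht)
      (fun t ht => by
        have h2 := hV t ht.1 fun s hs => hb s ⟨hs.1, hs.2.trans ht.2⟩
        have h3 := sq_add_sq_le_lorenzLyapunov hσ (X t) (Y t)
        calc |X t * Y t| ≤ X t ^ 2 + Y t ^ 2 := by
              rw [abs_le]
              constructor <;> nlinarith [sq_nonneg (X t + Y t), sq_nonneg (X t - Y t)]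
          _ ≤ _ := h3
          _ ≤ (4 + 2 / σ ^ 2) * (D * Real.exp (-r * t)) := by gcongr
          _ = _ := by ring) (Set.right_mem_Icc.2 hT)
    simpa [hZs0] using h1
  have hexp : ∀ T, 0 ≤ T → Real.exp (-r * T) ≤ 1 := fun T hT =>
    Real.exp_le_one_iff.2 (by nlinarith)
  -- At a first time τ with |Z - `Zs`| ≥ η, both halves hold on [0, τ] and `hDη` forces a value
  -- strictly below η.
  have hall : ∀ T, 0 ≤ T → |Z T - Zs T| ≤ η := by
    by_contra! hcon
    obtain ⟨T, hT, hTη⟩ := hcon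
    have hclosed : IsClosed {s | η ≤ |Z s - Zs s|} := isClosed_le continuous_const (by fun_prop)
    have hcomp : IsCompact (Set.Icc 0 T ∩ {s | η ≤ |Z s - Zs s|}) :=
      isCompact_Icc.inter_right hclosed
    obtain ⟨τ, hτ, hmin⟩ := hcomp.exists_isLeast ⟨T, ⟨hT, le_rfl⟩, hTη.le⟩
    have hlt : ∀ s ∈ Set.Ico 0 τ, |Z s - Zs s| ≤ η := fun s hs => by
      by_contra! hc
      exact absurd (hmin ⟨⟨hs.1, hs.2.le.trans hτ.1.2⟩, hc.le⟩) (not_le.2 hs.2)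
    have hτ0 : 0 < τ := by
      refine lt_of_le_of_ne hτ.1.1 fun h0 => ?_
      have h1 : η ≤ |Z τ - Zs τ| := hτ.2
      rw [← h0, hZs0, sub_zero] at h1
      have : 0 ≤ 2 * ((4 + 2 / σ ^ 2) * D) / β := by positivity
      linarith
    have hle : ∀ s ∈ Set.Icc 0 τ, |Z s - Zs s| ≤ η := by
      intro s hs
      have hcl : IsClosed {s | |Z s - Zs s| ≤ η} := isClosed_le (by fun_prop) continuous_const
      have := hcl.closure_subset_iff.2 (show Set.Ico 0 τ ⊆ {s | |Z s - Zs s| ≤ η} from hlt)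
      rw [closure_Ico hτ0.ne] at this
      exact this hs
    have h1 := hζ τ hτ0.le hle
    have h2 := hexp τ hτ0.le
    have h3 : 0 ≤ |Z 0| + 2 * ((4 + 2 / σ ^ 2) * D) / β := by positivity
    have h4 : η ≤ |Z τ - Zs τ| := hτ.2
    nlinarith
  refine ⟨hV t ht fun s hs => hall s hs.1, (hζ t ht fun s hs => hall s hs.1).trans ?_⟩
  gcongr

/-! ### From vector solutions to shrinking balls. -/

lemma continuous_lorenzDrift (σ ρ β : ℝ) : Continuous (lorenzDrift σ ρ β) := by
  unfold lorenzDrift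
  refine (PiLp.continuous_toLp 2 _).comp (continuous_pi fun i => ?_)
  fin_cases i <;> simp <;> fun_prop

lemma IsLorenzSolution.isLorenzPath {σ ρ β γ : ℝ} {w : ℝ≥0 → ℝ} {x : EuclideanSpace ℝ (Fin 3)}
    {u : ℝ≥0 → EuclideanSpace ℝ (Fin 3)} (h : IsLorenzSolution σ ρ β γ w x u) :
    IsLorenzPath σ ρ β (fun t => γ * (w t.toNNReal - w 0)) (fun t => u t.toNNReal 0)
      (fun t => u t.toNNReal 1) (fun t => u t.toNNReal 2) := by
  have hu : Continuous fun t : ℝ => u t.toNNReal := h.1.comp continuous_real_toNNReal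
  have hd : Continuous fun t : ℝ => lorenzDrift σ ρ β (u t.toNNReal) :=
    (continuous_lorenzDrift σ ρ β).comp hu
  have hc : ∀ i : Fin 3, Continuous fun t : ℝ => u t.toNNReal i := fun i =>
    (EuclideanSpace.proj i : EuclideanSpace ℝ (Fin 3) →L[ℝ] ℝ).continuous.comp hu
  have hint : ∀ (i : Fin 3) (t : ℝ), (∫ s in (0 : ℝ)..t, lorenzDrift σ ρ β (u s.toNNReal)) i
      = ∫ s in (0 : ℝ)..t, lorenzDrift σ ρ β (u s.toNNReal) i := fun i t =>
    ((EuclideanSpace.proj i : EuclideanSpace ℝ (Fin 3) →L[ℝ] ℝ).intervalIntegral_comp_comm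
      (hd.intervalIntegrable 0 t)).symm
  have h0 : u 0 = x := by
    have := h.2 0
    simp only [NNReal.coe_zero, intervalIntegral.integral_same, sub_self, mul_zero] at this
    rw [this]
    ext i
    fin_cases i <;> simp
  have hi : ∀ (i : Fin 3) (t : ℝ), 0 ≤ t → u t.toNNReal i = u 0 i
      + (∫ s in (0 : ℝ)..t, lorenzDrift σ ρ β (u s.toNNReal) i)
      + (!₂[0, 0, γ * (w t.toNNReal - w 0)] : EuclideanSpace ℝ (Fin 3)) i := by
    intro i t ht
    rw [← hint, h0]
    nth_rewrite 1 [h.2 t.toNNReal]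
    rw [Real.coe_toNNReal t ht]
    rfl
  refine ⟨hc 0, hc 1, hc 2, fun t ht => ?_, fun t ht => ?_, fun t ht => ?_⟩
  · simpa [lorenzDrift] using hi 0 t ht
  · simpa [lorenzDrift] using hi 1 t ht
  · simpa [lorenzDrift] using hi 2 t ht

/-- The solution from the origin stays on the `z`-axis. -/
lemma IsLorenzSolution.axis {σ ρ β γ : ℝ} (hσ : 0 < σ) (hρ : -1 ≤ ρ) {w : ℝ≥0 → ℝ}
    {u : ℝ≥0 → EuclideanSpace ℝ (Fin 3)} (h : IsLorenzSolution σ ρ β γ w 0 u) (t : ℝ)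
    (ht : 0 ≤ t) :
    u t.toNNReal 2 = (∫ s in (0 : ℝ)..t, -β * u s.toNNReal 2)
      + γ * (w t.toNNReal - w 0) := by
  have h0 : u 0 = 0 := by
    have := h.2 0
    simp only [NNReal.coe_zero, intervalIntegral.integral_same, sub_self, mul_zero] at this
    rw [this]
    ext i
    fin_cases i <;> simp
  have hp := h.isLorenzPath
  have hz := hp.eq_z t ht
  simp only [Real.toNNReal_zero, h0, PiLp.zero_apply, zero_add] at hz
  rw [hz]
  congr 1
  refine intervalIntegral.integral_congr fun s hs => ?_
  rw [Set.uIcc_of_le ht] at hs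
  have := (hp.eq_zero_of_eq_zero hσ hρ (by simp [h0]) (by simp [h0]) hs.1).1
  simp [this]

/-- Pathwise stability: if the solution from the origin has small time averages, the diameter of
the image of a small ball tends to zero. -/
lemma exists_ball_tendsto_ediam {σ ρ β γ C η : ℝ} (hσ : 0 < σ) (hβ : 0 < β) (hρ : -1 ≤ ρ)
    (hη : 0 < η) :
    ∃ ε : ℝ, 0 < ε ∧ ∀ (w : ℝ≥0 → ℝ)
      (u : EuclideanSpace ℝ (Fin 3) → ℝ≥0 → EuclideanSpace ℝ (Fin 3)),
      (∀ x, IsLorenzSolution σ ρ β γ w x (u x)) →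
      (∀ t : ℝ, 0 ≤ t → ∫ s in (0 : ℝ)..t, |u 0 s.toNNReal 2| ≤ C + (1 - ρ - 2 * η) * t) →
      Tendsto (fun n : ℕ => Metric.ediam ((fun x => u x n) '' Metric.ball 0 ε)) atTop (𝓝 0) := by
  set κ := σ / (1 + σ) with hκ
  have hκ0 : 0 < κ := by positivity
  set c := 4 + 2 / σ ^ 2 with hc
  have hc0 : 0 < c := by positivity
  set D' := (2 + 4 * σ ^ 2) * Real.exp (2 * κ * C) with hD'
  have hD'0 : 0 < D' := by positivity
  -- The entry 1 turns ε² into ε, so the Lyapunov bound is `D' * ε`; the other entry ensures the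
  -- smallness condition of `exp_decay`. Only C, η and the parameters enter, not the path.
  set ε := min 1 (η / (1 + 2 * (c * D') / β)) with hε
  have hε0 : 0 < ε := lt_min one_pos (by positivity)
  have hε1 : ε ≤ 1 := min_le_left _ _
  have hεη : ε * (1 + 2 * (c * D') / β) ≤ η := by
    rw [← le_div_iff₀ (by positivity)]; exact min_le_right _ _
  set r := min (β / 2) (2 * κ * η) with hr
  have hr0 : 0 < r := lt_min (by positivity) (by positivity)
  refine ⟨ε, hε0, fun w u hu hC => ?_⟩
  set R : ℕ → ℝ := fun n => √((c * (D' * ε) + η ^ 2) * Real.exp (-r * n)) with hR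
  have hRlim : Tendsto R atTop (𝓝 0) := by
    have h1 : Tendsto (fun n : ℕ => Real.exp (-r * n)) atTop (𝓝 0) := by
      refine Real.tendsto_exp_atBot.comp ?_
      exact tendsto_natCast_atTop_atTop.const_mul_atTop_of_neg (by linarith)
    simpa [hR] using (h1.const_mul (c * (D' * ε) + η ^ 2)).sqrt
  have hsub : ∀ n : ℕ, (fun x => u x n) '' Metric.ball 0 ε
      ⊆ Metric.closedBall !₂[0, 0, u 0 n 2] (R n) := by
    rintro n _ ⟨x, hx, rfl⟩
    rw [mem_ball_zero_iff] at hx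
    have hx2 : x 0 ^ 2 + x 1 ^ 2 + x 2 ^ 2 < ε ^ 2 := by
      have h1 := EuclideanSpace.norm_sq_eq x
      simp only [Fin.sum_univ_three, Real.norm_eq_abs, sq_abs] at h1
      rw [← h1]; gcongr
    have h0 : ∀ i, u x 0 i = x i := by
      intro i
      have := (hu x).2 0
      simp only [NNReal.coe_zero, intervalIntegral.integral_same, sub_self, mul_zero] at this
      rw [this]
      fin_cases i <;> simp
    have hz : |x 2| < ε := abs_lt_of_sq_lt_sq (by nlinarith [sq_nonneg (x 0), sq_nonneg (x 1)]) hε0.le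
    have hdec := (hu x).isLorenzPath.exp_decay (Zs := fun t => u 0 t.toNNReal 2)
      (r := r) (D := D' * ε) hσ hβ hρ (hu 0).isLorenzPath.continuous_z
      (fun t ht => (hu 0).axis hσ hρ t ht) hC (min_le_left _ _) (min_le_right _ _) hr0.le
      (by
        simp only [Real.toNNReal_zero, h0]
        have h1 := lorenzLyapunov_le σ (x 0) (x 1)
        have h2 : x 0 ^ 2 + x 1 ^ 2 ≤ ε := by nlinarith [sq_nonneg (x 2)]
        calc _ ≤ (2 + 4 * σ ^ 2) * ε * Real.exp (2 * κ * C) := by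
              gcongr
              exact h1.trans (by gcongr)
          _ = _ := by rw [hD']; ring)
      (by
        simp only [Real.toNNReal_zero, h0]
        calc _ < ε + 2 * (c * (D' * ε)) / β := by gcongr
          _ = ε * (1 + 2 * (c * D') / β) := by ring
          _ ≤ η := hεη)
      (t := n) (Nat.cast_nonneg n)
    simp only [Real.toNNReal_natCast] at hdec
    obtain ⟨hV, hZ⟩ := hdec
    have hxy := (sq_add_sq_le_lorenzLyapunov hσ (u x n 0) (u x n 1)).trans
      (mul_le_mul_of_nonneg_left hV hc0.le)
    have he : Real.exp (-r * n) ≤ 1 :=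
      Real.exp_le_one_iff.2 (by nlinarith [(Nat.cast_nonneg n : (0 : ℝ) ≤ n)])
    have hz2 : (u x n 2 - u 0 n 2) ^ 2 ≤ η ^ 2 * Real.exp (-r * n) := by
      calc _ = |u x n 2 - u 0 n 2| ^ 2 := (sq_abs _).symm
        _ ≤ (η * Real.exp (-r * n)) ^ 2 := by gcongr
        _ = η ^ 2 * Real.exp (-r * n) * Real.exp (-r * n) := by ring
        _ ≤ η ^ 2 * Real.exp (-r * n) * 1 := by gcongr
        _ = _ := mul_one _
    rw [Metric.mem_closedBall, EuclideanSpace.dist_eq]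
    refine Real.sqrt_le_sqrt ?_
    simp only [Fin.sum_univ_three, Real.dist_eq, sq_abs]
    change (u x n 0 - 0) ^ 2 + (u x n 1 - 0) ^ 2 + (u x n 2 - u 0 n 2) ^ 2 ≤ _
    rw [← hc] at hxy
    rw [sub_zero, sub_zero]
    linarith
  have hlim : Tendsto (fun n => 2 * ENNReal.ofReal (R n)) atTop (𝓝 0) := by
    have := ENNReal.Tendsto.const_mul (a := 2) (ENNReal.tendsto_ofReal hRlim) (Or.inr (by simp))
    simpa using this
  refine tendsto_of_tendsto_of_tendsto_of_le_of_le tendsto_const_nhds hlim (fun _ => zero_le)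
    fun n => (Metric.ediam_mono (hsub n)).trans ?_
  rw [← Metric.closedEBall_ofReal (Real.sqrt_nonneg _)]
  exact Metric.ediam_closedEBall_le

/-! ### Choice of constants and of the event. -/

theorem lemma4p3p3 {Ω : Type*} [MeasurableSpace Ω] (P : Measure Ω) [IsProbabilityMeasure P]
    (W : ℝ≥0 → Ω → ℝ) (hW : IsBrownianReal W P)
    (σ ρ β γ : ℝ) (hσ : 0 < σ) (hβ : 0 < β) (hρ : -1 ≤ ρ)
    (hγ : |γ| < (1 - ρ) * √(Real.pi * β))
    (φ : ℝ≥0 → Ω → EuclideanSpace ℝ (Fin 3) → EuclideanSpace ℝ (Fin 3))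
    (hφ : IsStochasticLorenzFlow P σ ρ β γ W φ) :
    LocallyAsymptoticallyStableAt P φ 0 := by
  set m := |γ| / √(Real.pi * β) with hm
  have hm0 : 0 ≤ m := by positivity
  have hmρ : m < 1 - ρ := by rwa [hm, div_lt_iff₀ (by positivity)]
  -- A quarter of the gap goes to Borel-Cantelli and a quarter to interpolation between squares; the
  -- remaining 2η is the margin for stability.
  set η := (1 - ρ - m) / 4 with hη
  have hη0 : 0 < η := by rw [hη]; linarith
  have hev := ae_eventually_lt_of_tendsto_ouEuler hW.toIsPreBrownianReal hβ γ
    (A := fun T ω => ∫ s in (0 : ℝ)..T, |φ s.toNNReal ω 0 2|)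
    (fun T => by
      filter_upwards [hφ] with ω hω
      exact tendsto_riemannSum_ouEuler hβ (hω 0).isLorenzPath.continuous_z
        (fun t ht => (hω 0).axis hσ hρ t ht) T) hη0
  set G : ℕ → Set Ω := fun C => {ω | (∀ x, IsLorenzSolution σ ρ β γ (fun t => W t ω) x
    (fun t => φ t ω x)) ∧ ∀ t : ℝ, 0 ≤ t →
      ∫ s in (0 : ℝ)..t, |φ s.toNNReal ω 0 2| ≤ C + (1 - ρ - 2 * η) * t} with hG
  have hcover : ∀ᵐ ω ∂P, ω ∈ ⋃ C, G C := by
    filter_upwards [hφ, hev] with ω hω hωev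
    have hc : Continuous fun s : ℝ => |φ s.toNNReal ω 0 2| :=
      (hω 0).isLorenzPath.continuous_z.abs
    have hmono : MonotoneOn (fun t : ℝ => ∫ s in (0 : ℝ)..t, |φ s.toNNReal ω 0 2|)
        (Set.Ici 0) := fun a ha b _ hab =>
      intervalIntegral.integral_mono_interval le_rfl ha hab
        (Eventually.of_forall fun _ => abs_nonneg _) (hc.intervalIntegrable _ _)
    obtain ⟨C, hC⟩ := exists_le_add_mul_of_eventually_sq hmono (c := m + η) (c' := m + 2 * η)
      (by positivity) (by linarith) hωev
    refine Set.mem_iUnion.2 ⟨C, hω, fun t ht => ?_⟩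
    have : m + 2 * η = 1 - ρ - 2 * η := by rw [hη]; ring
    rw [← this]
    exact hC t ht
  -- Countable subadditivity suffices, so no measurability of `G C` is needed.
  obtain ⟨C, hC⟩ : ∃ C, 0 < P (G C) := by
    by_contra! hcon
    have h1 : P (⋃ C, G C) = 0 := measure_iUnion_null fun C => nonpos_iff_eq_zero.1 (hcon C)
    have h2 : P Set.univ ≤ P (⋃ C, G C) := measure_mono_ae (by
      filter_upwards [hcover] with ω hω _ using hω)
    rw [h1, measure_univ] at h2
    exact absurd h2 (by simp)
  obtain ⟨ε, hε, hstab⟩ := exists_ball_tendsto_ediam (γ := γ) (C := C) hσ hβ hρ hη0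
  refine ⟨ε, hε, ⟨0, Metric.mem_ball_self hε⟩, Metric.isOpen_ball, fun n => (n : ℝ≥0),
    Nat.strictMono_cast, tendsto_natCast_atTop_atTop, hC.trans_le (measure_mono ?_)⟩
  rintro ω ⟨h1, h2⟩
  exact hstab (fun t => W t ω) (fun x t => φ t ω x) h1 h2
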